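/- All graphs are finite and simple. For graphs $G$ and $F$, let $N(G,F)$ denote the number of labeled copies of $F$ in $G$, i.e. the number of injections $\varphi: V(F)\to V(G)$ such that $\varphi(x)\varphi(y)\in E(G)$ for every $xy\in E(F)$. Let $H_{n,1}$ denote the $n$-vertex graph obtained from the complete graph $K_{n-1}$ by adding one new vertex that is adjacent to exactly one vertex of $K_{n-1}$. A graph is nonhamiltonian if it has no cycle through all of its vertices. For every graph $F$ with $t:=|V(F)|\ge 3$ and every integer $n\ge 9t+3$: if $G$ is an $n$-vertex nonhamiltonian graph, then $N(G,F)\le N(H_{n,1},F)$. -/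

import Mathlib

/-- The graph `H_{n,d}` on the vertex set `{0, …, n - 1}`. The vertices `i < n - d` form a clique `A`
on `n - d` vertices; each of the remaining `d` vertices is adjacent exactly to the `d` vertices
`0, …, d - 1` (which lie in `A` when `2 * d ≤ n`). -/
def Hgraph (n d : ℕ) : SimpleGraph (Fin n) :=
  SimpleGraph.fromRel fun i j =>
    ((i : ℕ) < n - d ∧ (j : ℕ) < n - d) ∨ ((i : ℕ) < d ∧ n - d ≤ (j : ℕ))

/-! ### Hamiltonicity and degrees. -/

namespace SimpleGraph

variable {V : Type*} [Fintype V] [DecidableEq V] {G : SimpleGraph V}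

/-! Enlarge G to an edge-maximal nonhamiltonian graph. By Ore's rotation, nonadjacent degrees sum to
less than n, and a nonadjacent pair of largest sum yields k < n/2 with a vertex of degree k and at
least k vertices of degree at most k. If k ≤ 1, the graph embeds in `Hgraph n 1`. Otherwise count
injections that are not copies. With t vertices in F, s of them nonisolated, and M injections for
any two prescribed values, `Hgraph n 1` has at most s(n-1)M failures. Two vertices of degree at most
k cause that many when 2k + t ≤ n (`le_card_bad_of_two_degree_le`); for larger k, the low-degree
vertices do so at a single edge of F (`le_card_bad_of_many_degree_le`). -/

/-- A Hamiltonian path whose ends are adjacent closes up to a Hamiltonian cycle. -/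
lemma Walk.IsHamiltonian.isHamiltonian_of_adj {u v : V} {p : G.Walk u v} (hp : p.IsHamiltonian)
    (hV : 3 ≤ Fintype.card V) (h : G.Adj v u) : G.IsHamiltonian := by
  intro _
  refine ⟨v, .cons h p, ⟨?_, fun x => by simpa using hp x⟩⟩
  rw [Walk.cons_isCycle_iff]
  refine ⟨hp.isPath, fun hmem => ?_⟩
  rw [Sym2.eq_swap] at hmem
  have h1 := hp.isPath.eq_snd_of_mem_edges hmem
  have hl := hp.length_eq
  have h2 := (hp.isPath.getVert_eq_end_iff (i := 1) (by omega)).1 h1.symm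
  omega

/-- Pigeonhole: the neighbours of `u`, shifted back by one, and those of `v` index subsets of the n
- 1 path positions, so they meet. -/
lemma Walk.IsHamiltonian.exists_crossing [DecidableRel G.Adj] {u v : V} {p : G.Walk u v}
    (hp : p.IsHamiltonian)
    (hdeg : Fintype.card V ≤ G.degree u + G.degree v) :
    ∃ i < p.length, G.Adj u (p.getVert (i + 1)) ∧ G.Adj v (p.getVert i) := by
  have hl := hp.length_eq
  have hpos : 0 < Fintype.card V := Fintype.card_pos_iff.2 ⟨u⟩
  by_contra! hno
  set A := (Finset.range p.length).filter fun i => G.Adj u (p.getVert (i + 1))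
  set B := (Finset.range p.length).filter fun i => G.Adj v (p.getVert i)
  have hA : G.degree u ≤ A.card := by
    rw [← card_neighborFinset_eq_degree]
    refine (Finset.card_le_card (t := A.image fun i => p.getVert (i + 1)) ?_).trans
      Finset.card_image_le
    intro x hx
    rw [mem_neighborFinset] at hx
    obtain ⟨i, rfl, hi⟩ := Walk.mem_support_iff_exists_getVert.1 (hp.mem_support x)
    rcases i with _ | i
    · simp at hx
    · exact Finset.mem_image.2 ⟨i, by simp [A, hx]; omega, rfl⟩
  have hB : G.degree v ≤ B.card := by
    rw [← card_neighborFinset_eq_degree]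
    refine (Finset.card_le_card (t := B.image fun i => p.getVert i) ?_).trans
      Finset.card_image_le
    intro x hx
    rw [mem_neighborFinset] at hx
    obtain ⟨i, rfl, hi⟩ := Walk.mem_support_iff_exists_getVert.1 (hp.mem_support x)
    rcases hi.eq_or_lt with rfl | hi
    · simp at hx
    · exact Finset.mem_image.2 ⟨i, by simp [B, hx, hi], rfl⟩
  have hdisj : Disjoint A B := by
    rw [Finset.disjoint_left]
    intro i hiA hiB
    simp only [A, B, Finset.mem_filter, Finset.mem_range] at hiA hiB
    exact hno i hiA.1 hiA.2 hiB.2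
  have hU : (A ∪ B).card ≤ p.length := by
    rw [← Finset.card_range p.length]
    exact Finset.card_le_card (Finset.union_subset (Finset.filter_subset _ _)
      (Finset.filter_subset _ _))
  rw [Finset.card_union_of_disjoint hdisj] at hU
  omega

/-- Ore's rotation: a Hamiltonian path whose ends have large degree sum yields a Hamiltonian
cycle. -/
lemma Walk.IsHamiltonian.isHamiltonian_of_card_le_degree_add_degree [DecidableRel G.Adj]
    {u v : V} {p : G.Walk u v} (hp : p.IsHamiltonian) (hV : 3 ≤ Fintype.card V)
    (hdeg : Fintype.card V ≤ G.degree u + G.degree v) : G.IsHamiltonian := by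
  obtain ⟨i, hi, hu, hv⟩ := hp.exists_crossing hdeg
  -- Follow the path to position `i`, jump to `v`, and return backwards to position `i + 1`, a
  -- neighbour of `u`.
  refine Walk.IsHamiltonian.isHamiltonian_of_adj
    (p := (p.take i).append (.cons hv.symm (p.drop (i + 1)).reverse)) ?_ hV hu.symm
  intro x
  have hx := hp x
  have hsupp : p.support = p.support.take (i + 1) ++ p.support.drop (i + 1) :=
    (List.take_append_drop _ _).symm
  rw [hsupp] at hx
  rw [Walk.support_append, Walk.support_take, Walk.support_cons, List.tail_cons,
    Walk.support_reverse, Walk.drop_support_eq_support_drop_min, min_eq_left (by omega)]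
  rw [List.count_append] at hx ⊢
  rwa [List.count_reverse]

/-- If adding the edge `uv` makes a nonhamiltonian graph hamiltonian, then there is a Hamiltonian
path from `v` to `u`. -/
lemma exists_isHamiltonian_walk_of_sup_edge {u v : V} (hV : 3 ≤ Fintype.card V)
    (hG : ¬ G.IsHamiltonian) (h : (G ⊔ edge u v).IsHamiltonian) :
    ∃ p : G.Walk v u, p.IsHamiltonian := by
  have : Nontrivial V := Fintype.one_lt_card_iff_nontrivial.1 (by omega)
  have hmem : ∀ e ∈ (G ⊔ edge u v).edgeSet, e ≠ s(u, v) → e ∈ G.edgeSet := by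
    intro e
    induction e with | _ x y
    simp only [mem_edgeSet, sup_adj, edge_adj, ne_eq, Sym2.eq_iff]
    tauto
  suffices H : ∃ p : (G ⊔ edge u v).Walk u u, p.IsHamiltonianCycle ∧ p.snd = v by
    obtain ⟨p, hp, hsnd⟩ := H
    cases p with
    | nil => exact absurd rfl hp.ne_nil
    | @cons _ w _ hadj q =>
      obtain rfl : w = v := by simpa using hsnd
      have hq : q.IsHamiltonian := fun x => by simpa using hp.isHamiltonian_tail x
      have hne := (Walk.cons_isCycle_iff _ _).1 hp.isCycle
      have hq' : ∀ e ∈ q.edges, e ∈ G.edgeSet := fun e he =>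
        hmem e (q.edges_subset_edgeSet he) fun h => hne.2 (h ▸ he)
      exact ⟨q.transfer G hq', fun x => by rw [Walk.support_transfer]; exact hq x⟩
  obtain ⟨p, hp⟩ := h.exists_isHamiltonianCycle u
  have huv : s(u, v) ∈ p.edges := by
    by_contra hne
    have hp' : ∀ e ∈ p.edges, e ∈ G.edgeSet := fun e he =>
      hmem e (p.edges_subset_edgeSet he) fun h => hne (h ▸ he)
    refine hG fun _ => ⟨u, p.transfer G hp', ?_⟩
    rw [Walk.isHamiltonianCycle_iff_isCycle_and_length_eq]
    exact ⟨hp.isCycle.transfer hp', by rw [Walk.length_transfer, hp.length_eq]⟩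
  have hv : v ∈ p.toSubgraph.neighborSet u := by
    rw [Subgraph.mem_neighborSet, Walk.adj_toSubgraph_iff_mem_edges]; exact huv
  rw [hp.isCycle.neighborSet_toSubgraph_endpoint] at hv
  rcases hv with hv | hv
  · exact ⟨p, hp, hv.symm⟩
  · refine ⟨p.reverse, ?_, by rw [Walk.snd_reverse]; exact hv.symm⟩
    rw [Walk.isHamiltonianCycle_iff_isCycle_and_length_eq]
    exact ⟨hp.isCycle.reverse, by rw [Walk.length_reverse, hp.length_eq]⟩

lemma exists_isPath_top_length_eq [Nonempty V] (m : ℕ) (hm : m < Fintype.card V) :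
    ∃ (u v : V) (p : (⊤ : SimpleGraph V).Walk u v), p.IsPath ∧ p.length = m := by
  induction m with
  | zero => exact ⟨Classical.arbitrary V, _, .nil, .nil, rfl⟩
  | succ m ih =>
    obtain ⟨u, v, p, hp, rfl⟩ := ih (by omega)
    obtain ⟨x, hx⟩ : ∃ x, x ∉ p.support.toFinset := by
      by_contra! hall
      have h1 := List.toFinset_card_le p.support
      rw [Finset.eq_univ_iff_forall.2 hall, Finset.card_univ, Walk.length_support] at h1
      omega
    rw [List.mem_toFinset] at hx
    have hxu : x ≠ u := fun h => hx (h ▸ p.start_mem_support)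
    exact ⟨x, v, .cons hxu p, (Walk.cons_isPath_iff _ _).2 ⟨hp, hx⟩, rfl⟩

lemma isHamiltonian_top (hV : 3 ≤ Fintype.card V) : (⊤ : SimpleGraph V).IsHamiltonian := by
  have : Nonempty V := Fintype.card_pos_iff.1 (by omega)
  obtain ⟨u, v, p, hp, hl⟩ := exists_isPath_top_length_eq (V := V) (Fintype.card V - 1) (by omega)
  have hH : p.IsHamiltonian := Walk.isHamiltonian_iff_isPath_and_length_eq.2 ⟨hp, hl⟩
  refine hH.isHamiltonian_of_adj hV fun h => ?_
  subst h
  rw [(Walk.isPath_iff_nil.1 hp).length_eq_zero] at hl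
  omega

/-- Pósa's theorem: a nonhamiltonian graph is contained in a graph with, for some `k < n / 2`, a
vertex of degree `k` and at least `k` vertices of degree at most `k`. -/
theorem exists_le_card_degree_le_of_not_isHamiltonian (hV : 3 ≤ Fintype.card V)
    (hG : ¬ G.IsHamiltonian) :
    ∃ (G' : SimpleGraph V) (_ : DecidableRel G'.Adj) (u : V), G ≤ G' ∧
      2 * G'.degree u < Fintype.card V ∧
      G'.degree u ≤ (Finset.univ.filter fun w => G'.degree w ≤ G'.degree u).card := by
  classical
  obtain ⟨G', hGG', hmax⟩ :=
    Finite.exists_le_maximal (p := fun G' : SimpleGraph V => ¬ G'.IsHamiltonian) hG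
  have hne : G' ≠ ⊤ := fun h => hmax.prop (h ▸ isHamiltonian_top hV)
  obtain ⟨a, b, hab, hnab⟩ := ne_top_iff_exists_not_adj.1 hne
  let P : Finset (V × V) := Finset.univ.filter fun x => x.1 ≠ x.2 ∧ ¬ G'.Adj x.1 x.2
  obtain ⟨⟨u, v⟩, huvP, hbest⟩ := P.exists_max_image
    (fun x => G'.degree x.1 + G'.degree x.2) ⟨(a, b), by simp [P, hab, hnab]⟩
  wlog hle : G'.degree u ≤ G'.degree v generalizing u v
  · refine this v u ?_ ?_ (by omega)
    · simpa [P, eq_comm, adj_comm] using huvP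
    · simpa only [add_comm (G'.degree v)] using hbest
  have huv : u ≠ v ∧ ¬ G'.Adj u v := by simpa [P] using huvP
  have hore : G'.degree u + G'.degree v < Fintype.card V := by
    by_contra! hcon
    have hham : (G' ⊔ edge u v).IsHamiltonian := by
      by_contra hnot
      have hle := hmax.le_of_ge hnot le_sup_left
      exact huv.2 (hle (Or.inr (by simp [edge_adj, huv.1])))
    obtain ⟨p, hp⟩ := exists_isHamiltonian_walk_of_sup_edge hV hmax.prop hham
    exact hmax.prop (hp.isHamiltonian_of_card_le_degree_add_degree hV (by omega))
  refine ⟨G', inferInstance, u, hGG', by omega, ?_⟩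
  -- A non-neighbour `w` of `v` of larger degree than `u` would beat the pair (u, v). There are n -
  -- 1 - deg v ≥ deg u such `w`.
  have hsub : G'ᶜ.neighborFinset v ⊆ Finset.univ.filter fun w => G'.degree w ≤ G'.degree u := by
    intro w hw
    rw [mem_neighborFinset, compl_adj] at hw
    have := hbest (w, v) (by simpa [P, eq_comm, adj_comm] using hw)
    simp only [Finset.mem_filter, Finset.mem_univ, true_and]
    simp only at this
    omega
  have := Finset.card_le_card hsub
  rw [card_neighborFinset_eq_degree, degree_compl] at this
  omega

end SimpleGraph

namespace SimpleGraph

open Finset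

/-! ### Counting injections that are not copies. -/

section Counting

open scoped Classical in
/-- The number of injections with two prescribed values at two points does not depend on the points
or on the values. -/
lemma exists_card_embedding_two_values_eq (W V : Type*) [Fintype W] [Fintype V] :
    ∃ M : ℕ, ∀ (w w' : W) (u v : V), w ≠ w' → u ≠ v →
      #{φ : W ↪ V | φ w = u ∧ φ w' = v} = M := by
  have key : ∀ (w w' a a' : W) (u v b b' : V), w ≠ w' → a ≠ a' → u ≠ v → b ≠ b' →
      #{φ : W ↪ V | φ w = u ∧ φ w' = v} ≤ #{φ : W ↪ V | φ a = b ∧ φ a' = b'} := by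
    intro w w' a a' u v b b' hw ha hu hb
    -- Relabelling both sides by 2-transitivity gives one inequality; symmetry gives equality.
    obtain ⟨σ, hσ, hσ'⟩ := (MulAction.is_two_pretransitive_iff (G := Equiv.Perm W) (α := W)).1
      (Equiv.Perm.isMultiplyPretransitive _ 2) ha hw
    obtain ⟨τ, hτ, hτ'⟩ := (MulAction.is_two_pretransitive_iff (G := Equiv.Perm V) (α := V)).1
      (Equiv.Perm.isMultiplyPretransitive _ 2) hu hb
    rw [Equiv.Perm.smul_def] at hσ hσ' hτ hτ'
    refine card_le_card_of_injOn
      (fun φ => (σ.toEmbedding.trans φ).trans τ.toEmbedding) ?_ ?_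
    · intro φ hφ
      simp only [coe_filter, mem_univ, true_and, Set.mem_ofPred_eq] at hφ
      simp [hσ, hσ', hφ.1, hφ.2, hτ, hτ']
    · intro φ _ ψ _ h
      ext x
      have := DFunLike.congr_fun h (σ.symm x)
      simpa using this
  by_cases h : ∃ (w w' : W) (u v : V), w ≠ w' ∧ u ≠ v
  · obtain ⟨w, w', u, v, hw, hu⟩ := h
    exact ⟨_, fun a a' b b' ha hb =>
      (key a a' w w' b b' u v ha hw hb hu).antisymm (key w w' a a' u v b b' hw ha hu hb)⟩
  · exact ⟨0, fun w w' u v hw hu => (h ⟨w, w', u, v, hw, hu⟩).elim⟩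

variable {V W : Type*} [Fintype V] [Fintype W] {F : SimpleGraph W} {M : ℕ}

open scoped Classical in
lemma card_embedding_value_eq
    (hM : ∀ (w w' : W) (u v : V), w ≠ w' → u ≠ v → #{φ : W ↪ V | φ w = u ∧ φ w' = v} = M)
    {w w' : W} (hw : w ≠ w') (u : V) :
    #{φ : W ↪ V | φ w = u} = (Fintype.card V - 1) * M := by
  rw [card_eq_sum_card_fiberwise (f := fun φ : W ↪ V => φ w') (t := univ.erase u)]
  · rw [← Finset.card_univ, ← card_erase_of_mem (mem_univ u), ← smul_eq_mul, ← sum_const]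
    refine sum_congr rfl fun v hv => ?_
    rw [filter_filter]
    exact hM w w' u v hw (ne_of_mem_erase hv).symm
  · intro φ hφ
    simp only [coe_filter, mem_univ, true_and, Set.mem_ofPred_eq] at hφ
    simp only [coe_erase, coe_univ, Set.mem_sdiff, Set.mem_univ, true_and, Set.mem_singleton_iff]
    rw [← hφ]
    exact fun h => hw (φ.injective h).symm

open scoped Classical in
/-- The vertices of `F` that are not isolated. -/
noncomputable def nonisolated (F : SimpleGraph W) : Finset W := {w | ∃ w', F.Adj w w'}

lemma mem_nonisolated {w : W} : w ∈ F.nonisolated ↔ ∃ w', F.Adj w w' := by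
  simp [nonisolated]

-- Injectivity makes the events for different `w` disjoint, so the count is exact.
open scoped Classical in
lemma card_embedding_hits_eq
    (hM : ∀ (w w' : W) (u v : V), w ≠ w' → u ≠ v → #{φ : W ↪ V | φ w = u ∧ φ w' = v} = M)
    (u : V) :
    #{φ : W ↪ V | ∃ w ∈ F.nonisolated, φ w = u} =
      #F.nonisolated * ((Fintype.card V - 1) * M) := by
  have h : ({φ : W ↪ V | ∃ w ∈ F.nonisolated, φ w = u} : Finset (W ↪ V)) =
      F.nonisolated.biUnion fun w => {φ : W ↪ V | φ w = u} := by
    ext φ; simp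
  rw [h, card_biUnion, ← smul_eq_mul, ← sum_const]
  · refine sum_congr rfl fun w hw => ?_
    obtain ⟨w', hw'⟩ := mem_nonisolated.1 hw
    exact card_embedding_value_eq hM hw'.ne u
  · intro w _ w' _ hne
    rw [Function.onFun, Finset.disjoint_left]
    intro φ h1 h2
    simp only [mem_filter, mem_univ, true_and] at h1 h2
    exact hne (φ.injective (h1.trans h2.symm))

open scoped Classical in
lemma labelledCopyCount_eq_card_embedding (G : SimpleGraph V) (F : SimpleGraph W) :
    G.labelledCopyCount F = #{φ : W ↪ V | ∀ a b, F.Adj a b → G.Adj (φ a) (φ b)} := by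
  rw [labelledCopyCount, ← Fintype.card_subtype]
  refine Fintype.card_congr
    { toFun := fun f => ⟨⟨f, f.injective⟩, fun a b h => f.toHom.map_adj h⟩
      invFun := fun φ => ⟨⟨φ.1, fun {a b} h => φ.2 a b h⟩, φ.1.injective⟩
      left_inv := fun f => rfl
      right_inv := fun φ => rfl }

lemma labelledCopyCount_le_of_copy {V' : Type*} [Fintype V'] {G : SimpleGraph V}
    {G' : SimpleGraph V'} (c : Copy G G') (F : SimpleGraph W) :
    G.labelledCopyCount F ≤ G'.labelledCopyCount F := by
  classical
  rw [labelledCopyCount, labelledCopyCount]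
  refine Fintype.card_le_of_injective (fun f => c.comp f) fun f g h => ?_
  ext x
  exact c.injective (DFunLike.congr_fun h x)

open scoped Classical in
lemma labelledCopyCount_add_card_bad (G : SimpleGraph V) (F : SimpleGraph W) :
    G.labelledCopyCount F + #{φ : W ↪ V | ∃ a b, F.Adj a b ∧ ¬ G.Adj (φ a) (φ b)} =
      Fintype.card (W ↪ V) := by
  rw [labelledCopyCount_eq_card_embedding, ← Finset.card_univ,
    ← card_filter_add_card_filter_not (s := (univ : Finset (W ↪ V)))
      (fun φ => ∀ a b, F.Adj a b → G.Adj (φ a) (φ b))]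
  simp

open scoped Classical in
/-- An embedding sending a nonisolated vertex to `u` is either not a copy, or maps some neighbour of
that vertex into the neighbourhood of `u`. -/
lemma card_embedding_hits_copy_le {G : SimpleGraph V}
    (hM : ∀ (w w' : W) (u v : V), w ≠ w' → u ≠ v → #{φ : W ↪ V | φ w = u ∧ φ w' = v} = M)
    (u : V) :
    #{φ : W ↪ V | (∃ w ∈ F.nonisolated, φ w = u) ∧ ∀ a b, F.Adj a b → G.Adj (φ a) (φ b)} ≤
      #F.nonisolated * (G.degree u * M) := by
  have hex : ∀ w : W, ∃ w', w ∈ F.nonisolated → F.Adj w w' := by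
    intro w
    by_cases hw : w ∈ F.nonisolated
    · obtain ⟨w', h⟩ := mem_nonisolated.1 hw
      exact ⟨w', fun _ => h⟩
    · exact ⟨w, fun h => (hw h).elim⟩
  choose g hg using hex
  refine (card_le_card (t := F.nonisolated.biUnion fun w => (G.neighborFinset u).biUnion fun x =>
    {φ : W ↪ V | φ w = u ∧ φ (g w) = x}) ?_).trans ?_
  · intro φ hφ
    simp only [mem_filter, mem_univ, true_and] at hφ
    obtain ⟨⟨w, hw, rfl⟩, hφ⟩ := hφ
    simp only [mem_biUnion, mem_filter, mem_univ, true_and, mem_neighborFinset]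
    exact ⟨w, hw, φ (g w), hφ _ _ (hg w hw), rfl, rfl⟩
  · refine card_biUnion_le_card_mul _ _ _ fun w hw => ?_
    rw [← card_neighborFinset_eq_degree]
    refine card_biUnion_le_card_mul _ _ _ fun x hx => ?_
    exact (hM _ _ _ _ (hg w hw).ne ((mem_neighborFinset _ _ _).1 hx).ne).le

open scoped Classical in
lemma card_embedding_hits_both_le
    (hM : ∀ (w w' : W) (u v : V), w ≠ w' → u ≠ v → #{φ : W ↪ V | φ w = u ∧ φ w' = v} = M)
    {u v : V} (huv : u ≠ v) :
    #(({φ : W ↪ V | ∃ w ∈ F.nonisolated, φ w = u} : Finset (W ↪ V)) ∩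
      ({φ : W ↪ V | ∃ w ∈ F.nonisolated, φ w = v} : Finset (W ↪ V))) ≤
      (#F.nonisolated * #F.nonisolated - #F.nonisolated) * M := by
  rw [← offDiag_card]
  refine (card_le_card (t := F.nonisolated.offDiag.biUnion fun x =>
    {φ : W ↪ V | φ x.1 = u ∧ φ x.2 = v}) ?_).trans ?_
  · intro φ hφ
    simp only [mem_inter, mem_filter, mem_univ, true_and] at hφ
    obtain ⟨⟨w, hw, rfl⟩, w', hw', rfl⟩ := hφ
    simp only [mem_biUnion, mem_filter, mem_univ, true_and, mem_offDiag]
    exact ⟨(w, w'), ⟨hw, hw', fun h => huv (congrArg φ h)⟩, rfl, rfl⟩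
  · refine card_biUnion_le_card_mul _ _ _ fun x hx => ?_
    exact (hM _ _ _ _ (mem_offDiag.1 hx).2.2 huv).le

open scoped Classical in
/-- Two vertices of small degree destroy many copies. -/
lemma le_card_bad_of_two_degree_le {G : SimpleGraph V}
    (hM : ∀ (w w' : W) (u v : V), w ≠ w' → u ≠ v → #{φ : W ↪ V | φ w = u ∧ φ w' = v} = M)
    {u v : V} (huv : u ≠ v) {k : ℕ} (hu : G.degree u ≤ k) (hv : G.degree v ≤ k)
    (hk : 2 * k + Fintype.card W ≤ Fintype.card V) :
    #F.nonisolated * ((Fintype.card V - 1) * M) ≤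
      #{φ : W ↪ V | ∃ a b, F.Adj a b ∧ ¬ G.Adj (φ a) (φ b)} := by
  set s := #F.nonisolated
  have hs : s ≤ Fintype.card W := card_le_univ _
  set B : Finset (W ↪ V) := {φ : W ↪ V | ∃ a b, F.Adj a b ∧ ¬ G.Adj (φ a) (φ b)}
  have hcov : ∀ x : V, ({φ : W ↪ V | ∃ w ∈ F.nonisolated, φ w = x} : Finset (W ↪ V)) ⊆
      B ∪ ({φ : W ↪ V | (∃ w ∈ F.nonisolated, φ w = x) ∧
        ∀ a b, F.Adj a b → G.Adj (φ a) (φ b)} : Finset (W ↪ V)) := by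
    intro x φ hφ
    simp only [mem_filter, mem_univ, true_and] at hφ
    simp only [B, mem_union, mem_filter, mem_univ, true_and]
    by_cases h : ∀ a b, F.Adj a b → G.Adj (φ a) (φ b)
    · exact Or.inr ⟨hφ, h⟩
    · push Not at h
      exact Or.inl h
  have h1 := card_union_add_card_inter
    ({φ : W ↪ V | ∃ w ∈ F.nonisolated, φ w = u} : Finset (W ↪ V))
    {φ : W ↪ V | ∃ w ∈ F.nonisolated, φ w = v}
  rw [card_embedding_hits_eq hM u, card_embedding_hits_eq hM v] at h1
  have h2 := card_embedding_hits_both_le (F := F) hM huv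
  have h3 := card_le_card (union_subset_union (hcov u) (hcov v))
  rw [union_union_union_comm, union_self] at h3
  have h4 := (h3.trans (card_union_le _ _)).trans
    (Nat.add_le_add_left (card_union_le _ _) _)
  have h5 := card_embedding_hits_copy_le (F := F) (G := G) hM u
  have h6 := card_embedding_hits_copy_le (F := F) (G := G) hM v
  have h7 : s * (G.degree u * M) ≤ s * (k * M) := by gcongr
  have h8 : s * (G.degree v * M) ≤ s * (k * M) := by gcongr
  -- Divided by sM, this reads 2k + s - 1 ≤ n - 1, which is `hk` with s ≤ t.
  have h9 : s * (k * M) + s * (k * M) + (s * s - s) * M ≤ s * ((Fintype.card V - 1) * M) := by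
    rcases Nat.eq_zero_or_pos s with h0 | h0
    · simp [h0]
    · have e1 : s * s - s = s * (s - 1) := by rw [Nat.mul_sub, mul_one]
      have e2 : s * (k * M) + s * (k * M) + s * (s - 1) * M = s * ((k + k + (s - 1)) * M) := by
        ring
      rw [e1, e2]
      gcongr
      omega
  change _ = s * _ + s * _ at h1
  change _ ≤ (s * s - s) * M at h2
  change _ ≤ s * _ at h5 h6
  omega

open scoped Classical in
/-- Many vertices of degree at most half destroy many copies already at one edge. -/
lemma le_card_bad_of_many_degree_le {G : SimpleGraph V}
    (hM : ∀ (w w' : W) (u v : V), w ≠ w' → u ≠ v → #{φ : W ↪ V | φ w = u ∧ φ w' = v} = M)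
    {k : ℕ} (hD : k ≤ #{u | G.degree u ≤ k}) (hk : 2 * k < Fintype.card V)
    (hWk : 2 * Fintype.card W ≤ k) :
    #F.nonisolated * ((Fintype.card V - 1) * M) ≤
      #{φ : W ↪ V | ∃ a b, F.Adj a b ∧ ¬ G.Adj (φ a) (φ b)} := by
  have hs : #F.nonisolated ≤ Fintype.card W := card_le_univ _
  rcases F.nonisolated.eq_empty_or_nonempty with h0 | ⟨w, hw⟩
  · simp [h0]
  obtain ⟨w', hw'⟩ := mem_nonisolated.1 hw
  set D : Finset V := {u | G.degree u ≤ k}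
  calc #F.nonisolated * ((Fintype.card V - 1) * M)
      ≤ k * ((Fintype.card V - 1 - k) * M) := by
        rw [← mul_assoc, ← mul_assoc]
        refine Nat.mul_le_mul_right _ ?_
        -- With m = n - 1 - k ≥ k and k ≥ 2s, km ≥ 2sm ≥ s(m + k).
        obtain ⟨m, hm⟩ : ∃ m, Fintype.card V - 1 = m + k := ⟨Fintype.card V - 1 - k, by omega⟩
        rw [hm, Nat.add_sub_cancel]
        have hkm : k ≤ m := by omega
        nlinarith
    _ ≤ #D * ((Fintype.card V - 1 - k) * M) := by gcongr
    _ ≤ ∑ u ∈ D, #(Gᶜ.neighborFinset u) * M := by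
        rw [← smul_eq_mul, ← sum_const]
        refine sum_le_sum fun u hu => ?_
        have hu : G.degree u ≤ k := by simpa [D] using hu
        rw [card_neighborFinset_eq_degree, degree_compl]
        gcongr
    _ = #(D.sigma fun u => Gᶜ.neighborFinset u) * M := by rw [card_sigma, sum_mul]
    _ = #((D.sigma fun u => Gᶜ.neighborFinset u).biUnion fun x =>
          {φ : W ↪ V | φ w = x.1 ∧ φ w' = x.2}) := by
        rw [card_biUnion, ← smul_eq_mul, ← sum_const]
        · refine sum_congr rfl fun x hx => ?_
          rw [mem_sigma, mem_neighborFinset] at hx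
          exact (hM _ _ _ _ hw'.ne hx.2.ne).symm
        · rintro ⟨u, v⟩ _ ⟨u', v'⟩ _ hne
          rw [Function.onFun, Finset.disjoint_left]
          intro φ h1 h2
          simp only [mem_filter, mem_univ, true_and] at h1 h2
          apply hne
          rw [← h1.1, ← h1.2, ← h2.1, ← h2.2]
    _ ≤ _ := by
        refine card_le_card fun φ hφ => ?_
        simp only [mem_biUnion, mem_sigma, mem_filter, mem_univ, true_and, mem_neighborFinset,
          compl_adj] at hφ
        obtain ⟨⟨u, v⟩, ⟨-, hadj⟩, rfl, rfl⟩ := hφ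
        simp only [mem_filter, mem_univ, true_and]
        exact ⟨w, w', hw', hadj.2⟩

end Counting

/-! ### Comparison with the extremal graph. -/

lemma Hgraph_one_adj_of_lt {n : ℕ} {i j : Fin n} (hi : (i : ℕ) < n - 1) (hj : (j : ℕ) < n - 1)
    (hij : i ≠ j) : (Hgraph n 1).Adj i j := by
  rw [Hgraph, fromRel_adj]
  exact ⟨hij, Or.inl (Or.inl ⟨hi, hj⟩)⟩

lemma Hgraph_one_adj_of_eq_zero {n : ℕ} {i j : Fin n} (hi : (i : ℕ) = 0) (hij : i ≠ j) :
    (Hgraph n 1).Adj i j := by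
  rw [Hgraph, fromRel_adj]
  have hne : (i : ℕ) ≠ j := fun h => hij (Fin.ext h)
  refine ⟨hij, Or.inl ?_⟩
  omega

variable {V W : Type*} [Fintype V] [Fintype W] {n : ℕ}

open scoped Classical in
/-- All injections that do not send a nonisolated vertex to the pendant vertex are copies. -/
lemma card_embedding_le_labelledCopyCount_Hgraph_add {F : SimpleGraph W} {M : ℕ}
    (hM : ∀ (w w' : W) (u v : V), w ≠ w' → u ≠ v → #{φ : W ↪ V | φ w = u ∧ φ w' = v} = M)
    (hn : 0 < n) (hV : Fintype.card V = n) :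
    Fintype.card (W ↪ V) ≤
      (Hgraph n 1).labelledCopyCount F + #F.nonisolated * ((Fintype.card V - 1) * M) := by
  let e : V ≃ Fin n := Fintype.equivFinOfCardEq hV
  let x : V := e.symm ⟨n - 1, by omega⟩
  rw [← card_embedding_hits_eq hM x, ← Finset.card_univ,
    ← card_filter_add_card_filter_not (s := (univ : Finset (W ↪ V)))
      (fun φ => ∃ w ∈ F.nonisolated, φ w = x), add_comm]
  refine Nat.add_le_add_right ?_ _
  rw [labelledCopyCount_eq_card_embedding]
  refine card_le_card_of_injOn (fun φ => φ.trans e.toEmbedding) ?_ ?_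
  · intro φ hφ
    simp only [coe_filter, mem_univ, true_and, Set.mem_ofPred_eq, not_exists, not_and] at hφ ⊢
    have hlt : ∀ w ∈ F.nonisolated, (e (φ w) : ℕ) < n - 1 := by
      intro w hw
      have h1 := (e (φ w)).isLt
      have h2 : (e (φ w) : ℕ) ≠ n - 1 := fun h =>
        hφ w hw (by rw [Equiv.eq_symm_apply]; exact Fin.ext h)
      omega
    intro a b hab
    refine Hgraph_one_adj_of_lt (hlt a (mem_nonisolated.2 ⟨b, hab⟩))
      (hlt b (mem_nonisolated.2 ⟨a, hab.symm⟩)) fun h => ?_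
    exact hab.ne (φ.injective (e.injective h))
  · intro φ _ ψ _ h
    ext w
    have := DFunLike.congr_fun h w
    simpa using this

/-- A graph with a vertex of degree at most one is a subgraph of `Hgraph n 1`. -/
lemma nonempty_copy_Hgraph_one {G : SimpleGraph V} [DecidableRel G.Adj] (hn : 2 ≤ n)
    (hV : Fintype.card V = n) {u : V} (hu : G.degree u ≤ 1) :
    Nonempty (Copy G (Hgraph n 1)) := by
  classical
  have : Nontrivial V := Fintype.one_lt_card_iff_nontrivial.1 (by omega)
  obtain ⟨v, hvu, hv⟩ : ∃ v, v ≠ u ∧ ∀ x, G.Adj u x → x = v := by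
    rw [← card_neighborFinset_eq_degree, Finset.card_le_one] at hu
    by_cases h : ∃ v, G.Adj u v
    · obtain ⟨v, hv⟩ := h
      exact ⟨v, hv.ne', fun x hx => hu x (by simpa using hx) v (by simpa using hv)⟩
    · obtain ⟨v, hv⟩ := exists_ne u
      exact ⟨v, hv, fun x hx => (h ⟨x, hx⟩).elim⟩
  let e₀ : V ≃ Fin n := Fintype.equivFinOfCardEq hV
  -- Move `u` to the pendant vertex n - 1 and its only possible neighbour `v` to 0.
  obtain ⟨σ, hσ, hσ'⟩ := (MulAction.is_two_pretransitive_iff (G := Equiv.Perm (Fin n)) (α := (Fin n))).1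
    (Equiv.Perm.isMultiplyPretransitive _ 2) (e₀.injective.ne hvu)
    (show (⟨0, by omega⟩ : Fin n) ≠ ⟨n - 1, by omega⟩ by simp; omega)
  let e : V ≃ Fin n := e₀.trans σ
  have hev : e v = ⟨0, by omega⟩ := hσ
  have heu : e u = ⟨n - 1, by omega⟩ := hσ'
  have hlt : ∀ x, x ≠ u → (e x : ℕ) < n - 1 := by
    intro x hx
    have h1 := (e x).isLt
    have h2 : (e x : ℕ) ≠ n - 1 := fun h => hx (e.injective (by rw [heu]; exact Fin.ext h))
    omega
  refine ⟨⟨⟨e, fun {a b} hab => ?_⟩, e.injective⟩⟩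
  by_cases ha : a = u
  · subst ha
    obtain rfl := hv b hab
    exact (Hgraph_one_adj_of_eq_zero (by rw [hev]) (e.injective.ne hvu)).symm
  by_cases hb : b = u
  · subst hb
    obtain rfl := hv a hab.symm
    exact Hgraph_one_adj_of_eq_zero (by rw [hev]) (e.injective.ne hvu)
  exact Hgraph_one_adj_of_lt (hlt a ha) (hlt b hb) (e.injective.ne hab.ne)

end SimpleGraph

/-- Here `G.labelledCopyCount F` is the number of injections from the vertices of `F` to the vertices
of `G` that map edges of `F` to edges of `G`. -/
theorem corollary2p2 {V W : Type*} [Fintype V] [DecidableEq V] [Fintype W]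
    (F : SimpleGraph W) (hF : 3 ≤ Fintype.card W)
    (n : ℕ) (hn : 9 * Fintype.card W + 3 ≤ n)
    (G : SimpleGraph V) (hV : Fintype.card V = n) (hG : ¬ G.IsHamiltonian) :
    G.labelledCopyCount F ≤ (Hgraph n 1).labelledCopyCount F := by
  classical
  obtain ⟨G', inst, u, hGG', hu, hD⟩ :=
    SimpleGraph.exists_le_card_degree_le_of_not_isHamiltonian (by omega) hG
  obtain rfl : inst = fun a b => Classical.propDecidable _ := Subsingleton.elim _ _
  refine (SimpleGraph.labelledCopyCount_le_of_copy (SimpleGraph.Copy.ofLE G G' hGG') F).trans ?_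
  by_cases hu1 : G'.degree u ≤ 1
  · obtain ⟨c⟩ := SimpleGraph.nonempty_copy_Hgraph_one (n := n) (by omega) hV hu1
    exact SimpleGraph.labelledCopyCount_le_of_copy c F
  obtain ⟨M, hM⟩ := SimpleGraph.exists_card_embedding_two_values_eq W V
  have hH := SimpleGraph.card_embedding_le_labelledCopyCount_Hgraph_add (F := F) hM
    (by omega) hV
  have htot := SimpleGraph.labelledCopyCount_add_card_bad G' F
  suffices hbad : F.nonisolated.card * ((Fintype.card V - 1) * M) ≤
      (Finset.univ.filter fun φ : W ↪ V => ∃ a b, F.Adj a b ∧ ¬ G'.Adj (φ a) (φ b)).card by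
    omega
  by_cases hk : 2 * G'.degree u + Fintype.card W ≤ Fintype.card V
  · obtain ⟨a, ha, b, hb, hab⟩ := Finset.one_lt_card.1 (lt_of_lt_of_le (not_le.1 hu1) hD)
    rw [Finset.mem_filter] at ha hb
    exact SimpleGraph.le_card_bad_of_two_degree_le hM hab ha.2 hb.2 hk
  -- Here 2k > n - t ≥ 8t + 3, so k ≥ 2t.
  · exact SimpleGraph.le_card_bad_of_many_degree_le hM hD hu (by omega)
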